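/- **Setting.** Let $S$ be a finite set of sellers, $0\le t_0<t_f$, $\rho\in\mathbb R$, $\pi_{\min}\ge 0$, $\pi_{\max}>0$, $D_{\min}>0$, $\tau>0$, $m\in\mathbb N$, and let $K_s\in\mathbb R$ be the initial inventory of seller $s$. Prices $\pi_s$ and realized demands $D_s$ are elements of $L^2[t_0,t_f]$; a price $\pi_s$ is feasible if $\pi_{\min}\le\pi_s(t)\le\pi_{\max}$ for a.e. $t$. The uncertain parameter of seller $s$ ranges over the ball $U_s=\{\xi_s^0+\tau\psi:\|\psi\|\le 1\}$ of the Hilbert space $(L^2[t_0,t_f])^m$, where $\|\psi\|^2=\int_{t_0}^{t_f}\psi(t)^T\psi(t)\,dt$. For $t\in[t_0,t_f]$, a price vector $p=(p_s,p_{-s})\in\mathbb R^S$ and a parameter $\xi_s$, let $h_s(t,p;\xi_s)\in\mathbb R$ be the demand observed by seller $s$ at time $t$ when the prices charged at time $t$ are $p$; write $h_s(\pi(t);\xi_s)=h_s(t,\pi(t);\xi_s)$, and let $\nabla_{\xi_s}h_s(\pi(t);\xi_s)\in (L^2[t_0,t_f])^m$ be the gradient with respect to the parameter. Assume, for every $s\in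 S$, every $t\in[t_0,t_f]$, every $p\in[\pi_{\min},\pi_{\max}]^S$ and every $\xi_s\in U_s$: * (regularity) $h_s$ is continuous in $p$ on $[\pi_{\min},\pi_{\max}]^S$, and $t\mapsto h_s(\pi(t);\xi_s)$ is in $L^2[t_0,t_f]$ for all feasible price paths $\pi=(\pi_r)_{r\in S}$; * (A1) $\sup_{\xi_s,p_{-s}}h_s(t,\pi_{\max},p_{-s};\xi_s)=0$, the supremum being over $\xi_s\in U_s$ and $p_{-s}\in[\pi_{\min},\pi_{\max}]^{S\setminus\{s\}}$; * (A3) $h_s$ is concave in $p$ on $[\pi_{\min},\pi_{\max}]^S$; * (A4) for all feasible competitors' prices $\bar\pi_{-s}$ and all feasible $\pi_s^1\ne\pi_s^2$ in $L^2[t_0,t_f]$, $$\int_{t_0}^{t_f}e^{-t}\bigl[h_s(\pi_s^1(t),\bar\pi_{-s}(t);\xi_s)-h_s(\pi_s^2(t),\bar\pi_{-s}(t);\xi_s)\bigr]\bigl(\pi_s^1(t)-\pi_s^2(t)\bigr)\,dt<0;$$ * (A5) $h_s$ is twice continuously differentiable and linear in the parameter on $U_s$: $\partial^2h_s/\partial\xi_s^2=0$;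 * (A6) $\|\nabla_{\xi_s}h_s(t,p_s,p_{-s};\xi_s)\|$ is monotone increasing (in the weak sense) in own price $p_s\in[\pi_{\min},\pi_{\max}]$. **Theorem (existence of a robust best response).** For every seller $s\in S$ and all feasible prices $\pi_{-s}$ of the competitors, the robust best response problem of seller $s$, $$\max_{(\pi_s,D_s)\in L^2[t_0,t_f]\times L^2[t_0,t_f]}\ \int_{t_0}^{t_f}e^{-\rho t}\pi_s(t)D_s(t)\,dt$$ subject to $$D_s(t)-h_s(\pi_s(t),\pi_{-s}(t);\xi_s^0)+\tau\bigl\|\nabla_{\xi_s}h_s(\pi_s(t),\pi_{-s}(t);\xi_s^0)\bigr\|\le 0,\qquad K_s=\int_{t_0}^{t_f}D_s(t)\,dt,$$ $$\pi_{\min}\le\pi_s(t)\le\pi_{\max},\qquad D_s(t)\ge D_{\min}$$ (pointwise constraints for a.e. $t\in[t_0,t_f]$), has a solution whenever these constraints can be satisfied. -/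

import Mathlib

open MeasureTheory Set
open scoped Gradient

/-- Lebesgue measure on the planning horizon `[t₀, t_f]`. -/
noncomputable abbrev horizonMeasure (t₀ t_f : ℝ) : Measure ℝ :=
  volume.restrict (Icc t₀ t_f)

/-- The Hilbert space `L²[t₀, t_f]` of price paths and of realized-demand paths. -/
abbrev PathSpace (t₀ t_f : ℝ) : Type :=
  Lp ℝ 2 (horizonMeasure t₀ t_f)

/-- The Hilbert space `(L²[t₀, t_f])^m` of uncertain parameters, whose norm is
`‖ψ‖² = ∫ ψ(t)ᵀ ψ(t) dt`. -/
abbrev ParamSpace (t₀ t_f : ℝ) (m : ℕ) : Type :=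
  Lp (EuclideanSpace ℝ (Fin m)) 2 (horizonMeasure t₀ t_f)

/-- The data of the oligopolistic pricing model with set of sellers `S` and `m` uncertain
parameters per seller. -/
structure PricingModel (S : Type*) (m : ℕ) where
  /-- initial time -/
  t₀ : ℝ
  /-- terminal time -/
  t_f : ℝ
  /-- discount rate -/
  ρ : ℝ
  /-- lower price bound -/
  priceMin : ℝ
  /-- upper price bound -/
  priceMax : ℝ
  /-- lower bound for realized demand -/
  demandMin : ℝ
  /-- initial inventories -/
  K : S → ℝ
  /-- nominal parameter values -/
  ξ₀ : S → ParamSpace t₀ t_f m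
  /-- magnitude of the uncertainty -/
  τ : ℝ
  /-- `h s t p ξ` is the demand observed by seller `s` at time `t` when the prices charged at
  that time are `p` and the parameter of seller `s` is realized as `ξ`. -/
  h : S → ℝ → (S → ℝ) → ParamSpace t₀ t_f m → ℝ
  t₀_nonneg : 0 ≤ t₀
  t₀_lt_t_f : t₀ < t_f
  priceMin_nonneg : 0 ≤ priceMin
  priceMax_pos : 0 < priceMax
  demandMin_pos : 0 < demandMin
  τ_pos : 0 < τ

namespace PricingModel

variable {S : Type*} {m : ℕ}

/-- Lebesgue measure on the horizon of the model. -/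
noncomputable abbrev μ (M : PricingModel S m) : Measure ℝ := horizonMeasure M.t₀ M.t_f

/-- Price paths and realized-demand paths of the model. -/
abbrev Path (M : PricingModel S m) : Type := PathSpace M.t₀ M.t_f

/-- Uncertain parameters of the model. -/
abbrev Param (M : PricingModel S m) : Type := ParamSpace M.t₀ M.t_f m

/-- The uncertainty set `U_s = {ξ_s⁰ + τ ψ : ‖ψ‖ ≤ 1}`. -/
def U (M : PricingModel S m) (s : S) : Set M.Param :=
  {ξ | ∃ ψ : M.Param, ‖ψ‖ ≤ 1 ∧ ξ = M.ξ₀ s + M.τ • ψ}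

/-- The price vectors that respect the price bounds. -/
def priceBox (M : PricingModel S m) : Set (S → ℝ) :=
  {p | ∀ r, p r ∈ Icc M.priceMin M.priceMax}

/-- A price path respects the price bounds. -/
def FeasiblePrice (M : PricingModel S m) (x : M.Path) : Prop :=
  ∀ᵐ t ∂M.μ, M.priceMin ≤ x t ∧ x t ≤ M.priceMax

/-- The observed demand path `t ↦ h_s(π(t); ξ)` of seller `s` for the price paths `π`. -/
noncomputable def demandPath (M : PricingModel S m) (s : S) (π : S → M.Path) (ξ : M.Param) :
    ℝ → ℝ :=
  fun t => M.h s t (fun r => π r t) ξ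

/-- `∇_ξ h_s(p; ξ)` at time `t`: the gradient, in the Hilbert space `(L²[t₀, t_f])^m`, of the
demand as a function of the parameter, which ranges over the uncertainty set. -/
noncomputable def demandGradient (M : PricingModel S m) (s : S) (t : ℝ) (p : S → ℝ)
    (ξ : M.Param) : M.Param :=
  gradientWithin (M.h s t p) (M.U s) ξ

/-- The standing regularity conditions on the demand functions. -/
structure Regular [DecidableEq S] (M : PricingModel S m) : Prop where
  /-- Demand paths generated by feasible price paths are square integrable. -/
  memLp : ∀ s, ∀ π : S → M.Path, (∀ r, M.FeasiblePrice (π r)) → ∀ ξ ∈ M.U s,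
    MemLp (M.demandPath s π ξ) 2 M.μ
  /-- Demand is continuous in the prices. -/
  continuousOn : ∀ s, ∀ t ∈ Icc M.t₀ M.t_f, ∀ ξ ∈ M.U s,
    ContinuousOn (fun p => M.h s t p ξ) M.priceBox
  /-- The largest demand at the maximal own price is zero. -/
  sup_priceMax : ∀ s, ∀ t ∈ Icc M.t₀ M.t_f,
    IsLUB {y | ∃ p ∈ M.priceBox, p s = M.priceMax ∧ ∃ ξ ∈ M.U s, y = M.h s t p ξ} 0
  /-- Demand is concave in the prices. -/
  concaveOn : ∀ s, ∀ t ∈ Icc M.t₀ M.t_f, ∀ ξ ∈ M.U s,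
    ConcaveOn ℝ M.priceBox (fun p => M.h s t p ξ)
  /-- Demand is strictly monotonically decreasing in own price. -/
  strictly_decreasing : ∀ s, ∀ π : S → M.Path, (∀ r ≠ s, M.FeasiblePrice (π r)) →
    ∀ ξ ∈ M.U s, ∀ x₁ x₂ : M.Path, M.FeasiblePrice x₁ → M.FeasiblePrice x₂ → x₁ ≠ x₂ →
    ∫ t, Real.exp (-t) * ((M.demandPath s (Function.update π s x₁) ξ t
      - M.demandPath s (Function.update π s x₂) ξ t) * (x₁ t - x₂ t)) ∂M.μ < 0
  /-- Demand is linear in the parameter: its second derivative in the parameter vanishes. -/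
  linear_param : ∀ s, ∀ t ∈ Icc M.t₀ M.t_f, ∀ p ∈ M.priceBox,
    ContDiffOn ℝ 2 (M.h s t p) (M.U s) ∧
    ∀ ξ ∈ M.U s, fderivWithin ℝ (fderivWithin ℝ (M.h s t p) (M.U s)) (M.U s) ξ = 0
  /-- The norm of the parameter gradient is monotone increasing in own price. -/
  gradient_monotone : ∀ s, ∀ t ∈ Icc M.t₀ M.t_f, ∀ p ∈ M.priceBox, ∀ ξ ∈ M.U s,
    MonotoneOn (fun x => ‖M.demandGradient s t (Function.update p s x) ξ‖)
      (Icc M.priceMin M.priceMax)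

/-- The robust strategy space of seller `s`: the pairs `(π_s, D_s)` of a price path and a
realized-demand path that satisfy the constraints of the robust best response problem, given
the prices of the competitors. Only the components `π r` with `r ≠ s` matter. -/
def robustStrategySpace [DecidableEq S] (M : PricingModel S m) (s : S) (π : S → M.Path) :
    Set (M.Path × M.Path) :=
  {v |
    (∀ᵐ t ∂M.μ,
      v.2 t - M.demandPath s (Function.update π s v.1) (M.ξ₀ s) t
        + M.τ * ‖M.demandGradient s t (fun r => Function.update π s v.1 r t) (M.ξ₀ s)‖ ≤ 0) ∧
    M.K s = ∫ t, v.2 t ∂M.μ ∧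
    (∀ᵐ t ∂M.μ, M.priceMin ≤ v.1 t) ∧
    (∀ᵐ t ∂M.μ, v.1 t ≤ M.priceMax) ∧
    (∀ᵐ t ∂M.μ, M.demandMin ≤ v.2 t)}

/-- The discounted revenue `J_s(π_s, D_s) = ∫ exp(-ρ t) π_s(t) D_s(t) dt`. -/
noncomputable def revenue (M : PricingModel S m) (v : M.Path × M.Path) : ℝ :=
  ∫ t, Real.exp (-M.ρ * t) * (v.1 t * v.2 t) ∂M.μ

/-- `v` solves the robust best response problem of seller `s` against the prices `π`. -/
def IsRobustBestResponse [DecidableEq S] (M : PricingModel S m) (s : S) (π : S → M.Path)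
    (v : M.Path × M.Path) : Prop :=
  v ∈ M.robustStrategySpace s π ∧ ∀ w ∈ M.robustStrategySpace s π, M.revenue w ≤ M.revenue v

end PricingModel

/-! ### Convex substitutes for weak compactness in Hilbert space. -/

open Filter Topology

/-! The revenue is a bilinear form `B x d` in price and demand, in general neither concave nor
weakly upper semicontinuous, so weak compactness of the strategy space alone does not give a
maximizer. The shape of the constraints makes up for this.

Linearity in the parameter turns the robust constraint into `d ≤ h(x; ξ)` for every `ξ` in the
uncertainty ball (`Regular.robust_iff`). By concavity of demand, the admissible pairs `(x, d)` at
almost every time form a closed convex set, downward closed in `d` as far as the positive lower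
bound.

For a fixed demand path the best price path is the pointwise largest admissible one, and where one
demand path lies below another, its best price is at least the other's. Best pairs therefore satisfy
`B (y₁ - y₂) (d₁ - d₂) ≤ 0`, which says that `d ↦ max_x B x d` is concave
(`exists_max_integral_weight_mul`). Its superlevel sets are then convex, and a maximizer is found by
intersecting nested bounded closed convex sets (`exists_isMaxOn_bilinear`). -/

/-- A decreasing sequence of nonempty bounded closed convex subsets of a Hilbert space has a
common point. -/
theorem Antitone.exists_forall_mem_of_convex {E : Type*} [NormedAddCommGroup E]
    [InnerProductSpace ℝ E] [CompleteSpace E] {C : ℕ → Set E} (hanti : Antitone C)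
    (hne : ∀ n, (C n).Nonempty) (hclosed : ∀ n, IsClosed (C n)) (hconv : ∀ n, Convex ℝ (C n))
    {R : ℝ} (hR : ∀ x ∈ C 0, ‖x‖ ≤ R) : ∃ x, ∀ n, x ∈ C n := by
  -- The points of minimal norm have increasing bounded norms, and the parallelogram law will make
  -- them a Cauchy sequence.
  have hmin : ∀ n, ∃ x ∈ C n, ∀ y ∈ C n, ‖x‖ ≤ ‖y‖ := by
    intro n
    obtain ⟨x, hx, hxe⟩ := exists_norm_eq_iInf_of_complete_convex (hne n)
      (hclosed n).isComplete (hconv n) 0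
    refine ⟨x, hx, fun y hy => ?_⟩
    have h : ⨅ w : C n, ‖(0 : E) - w‖ ≤ ‖(0 : E) - (⟨y, hy⟩ : C n)‖ :=
      ciInf_le ⟨0, by rintro _ ⟨w, rfl⟩; exact norm_nonneg _⟩ _
    rw [← hxe] at h
    simpa using h
  choose x hx hxmin using hmin
  have hmono : Monotone fun n => ‖x n‖ ^ 2 := fun n k hnk =>
    pow_le_pow_left₀ (norm_nonneg _) (hxmin n _ (hanti hnk (hx k))) 2
  have hbdd : BddAbove (range fun n => ‖x n‖ ^ 2) := by
    refine ⟨R ^ 2, ?_⟩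
    rintro _ ⟨n, rfl⟩
    exact pow_le_pow_left₀ (norm_nonneg _) (hR _ (hanti (Nat.zero_le n) (hx n))) 2
  have hlim := tendsto_atTop_ciSup hmono hbdd
  have hpar : ∀ n k, n ≤ k → dist (x n) (x k) ^ 2 ≤ 2 * (‖x k‖ ^ 2 - ‖x n‖ ^ 2) := by
    intro n k hnk
    have hmid : (2⁻¹ : ℝ) • x n + (2⁻¹ : ℝ) • x k ∈ C n :=
      hconv n (hx n) (hanti hnk (hx k)) (by norm_num) (by norm_num) (by norm_num)
    have h1 := hxmin n _ hmid
    rw [← smul_add, norm_smul, Real.norm_of_nonneg (by norm_num)] at h1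
    have h2 := parallelogram_law_with_norm ℝ (x n) (x k)
    rw [dist_eq_norm]
    nlinarith [norm_nonneg (x n), norm_nonneg (x n + x k)]
  have hcauchy : CauchySeq x := by
    rw [Metric.cauchySeq_iff']
    intro ε hε
    obtain ⟨N, hN⟩ := Metric.cauchySeq_iff'.1 hlim.cauchySeq (ε ^ 2 / 2) (by positivity)
    refine ⟨N, fun n hn => ?_⟩
    have h1 := hN n hn
    rw [Real.dist_eq] at h1
    have h2 := hpar N n hn
    rw [dist_comm]
    exact lt_of_pow_lt_pow_left₀ 2 hε.le (by linarith [le_abs_self (‖x n‖ ^ 2 - ‖x N‖ ^ 2)])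
  obtain ⟨a, ha⟩ := cauchySeq_tendsto_of_complete hcauchy
  exact ⟨a, fun n => (hclosed n).mem_of_tendsto ha
    ((eventually_ge_atTop n).mono fun k hk => hanti hk (hx k))⟩

/-- A bounded linear functional attains its maximum on a nonempty bounded closed convex subset of a
Hilbert space. -/
theorem ContinuousLinearMap.exists_isMaxOn_of_convex {E : Type*} [NormedAddCommGroup E]
    [InnerProductSpace ℝ E] [CompleteSpace E] (f : E →L[ℝ] ℝ) {A : Set E} (hne : A.Nonempty)
    (hclosed : IsClosed A) (hconv : Convex ℝ A) {R : ℝ} (hR : ∀ x ∈ A, ‖x‖ ≤ R) :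
    ∃ x ∈ A, IsMaxOn f A x := by
  have hbdd : BddAbove (f '' A) := by
    refine ⟨‖f‖ * R, ?_⟩
    rintro _ ⟨x, hx, rfl⟩
    exact (le_abs_self _).trans ((f.le_opNorm x).trans (by gcongr; exact hR x hx))
  obtain ⟨x, hx⟩ := Antitone.exists_forall_mem_of_convex
    (C := fun n : ℕ => {x ∈ A | sSup (f '' A) - 1 / ((n : ℝ) + 1) ≤ f x})
    (fun n k hnk x hx => ⟨hx.1, le_trans (by gcongr) hx.2⟩)
    (fun n => by
      obtain ⟨_, ⟨x, hx, rfl⟩, h⟩ := exists_lt_of_lt_csSup (hne.image f)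
        (sub_lt_self (sSup (f '' A)) (Nat.one_div_pos_of_nat (α := ℝ) (n := n)))
      exact ⟨x, hx, h.le⟩)
    (fun n => hclosed.inter (isClosed_le continuous_const f.continuous))
    (fun n => hconv.inter (convex_halfSpace_ge f.toLinearMap.isLinear _))
    (fun x hx => hR x hx.1)
  refine ⟨x, (hx 0).1, fun y hy => ?_⟩
  have hlim : Tendsto (fun n : ℕ => sSup (f '' A) - 1 / ((n : ℝ) + 1)) atTop
      (𝓝 (sSup (f '' A) - 0)) := tendsto_const_nhds.sub tendsto_one_div_add_atTop_nhds_zero_nat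
  have h1 : sSup (f '' A) - 0 ≤ f x := le_of_tendsto' hlim fun n => (hx n).2
  have h2 := le_csSup hbdd (mem_image_of_mem f hy)
  change f y ≤ f x
  linarith

/-- A bounded bilinear form attains its maximum on a nonempty bounded closed convex set of pairs, if
the projections of its superlevel sets to the second factor are convex. -/
theorem exists_isMaxOn_bilinear {E G : Type*} [NormedAddCommGroup E]
    [InnerProductSpace ℝ E] [CompleteSpace E] [NormedAddCommGroup G] [InnerProductSpace ℝ G]
    [CompleteSpace G] (B : E →L[ℝ] G →L[ℝ] ℝ) {F : Set (E × G)} (hne : F.Nonempty)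
    (hclosed : IsClosed F) (hconv : Convex ℝ F) {R : ℝ} (hR : ∀ v ∈ F, ‖v‖ ≤ R)
    (hlevel : ∀ c, Convex ℝ {d | ∃ x, (x, d) ∈ F ∧ c ≤ B x d}) :
    ∃ v ∈ F, ∀ w ∈ F, B w.1 w.2 ≤ B v.1 v.2 := by
  have hR0 : 0 ≤ R := let ⟨v, hv⟩ := hne; (norm_nonneg v).trans (hR v hv)
  set J : E × G → ℝ := fun v => B v.1 v.2 with hJ
  have hJc : Continuous J := by fun_prop
  have hbdd : BddAbove (J '' F) := by
    refine ⟨‖B‖ * R * R, ?_⟩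
    rintro _ ⟨v, hv, rfl⟩
    refine (le_abs_self _).trans ((B.le_opNorm₂ v.1 v.2).trans ?_)
    have := hR v hv
    gcongr
    · exact (norm_fst_le v).trans this
    · exact (norm_snd_le v).trans this
  set σ := sSup (J '' F) with hσ
  have hε : Tendsto (fun n : ℕ => 1 / ((n : ℝ) + 1)) atTop (𝓝 0) :=
    tendsto_one_div_add_atTop_nhds_zero_nat
  obtain ⟨d, hd⟩ := Antitone.exists_forall_mem_of_convex
    (C := fun n : ℕ => closure {d | ∃ x, (x, d) ∈ F ∧ σ - 1 / ((n : ℝ) + 1) ≤ B x d})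
    (fun n k hnk => closure_mono fun d ⟨x, hx, h⟩ => ⟨x, hx, le_trans (by gcongr) h⟩)
    (fun n => by
      obtain ⟨_, ⟨v, hv, rfl⟩, h⟩ := exists_lt_of_lt_csSup (hne.image J)
        (sub_lt_self σ (Nat.one_div_pos_of_nat (α := ℝ) (n := n)))
      exact ⟨v.2, subset_closure ⟨v.1, hv, h.le⟩⟩)
    (fun n => isClosed_closure) (fun n => (hlevel _).closure) (R := R)
    (fun d hd => by
      have : closure {d | ∃ x, (x, d) ∈ F ∧ σ - 1 / (((0 : ℕ) : ℝ) + 1) ≤ B x d}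
          ⊆ {d | ‖d‖ ≤ R} :=
        closure_minimal (fun d ⟨x, hx, _⟩ => (norm_snd_le (x, d)).trans (hR _ hx))
          (isClosed_le continuous_norm continuous_const)
      exact this hd)
  -- The `1` pays for the near-optimality of the pair `(x, d')`, the term `‖B‖ * R` for replacing
  -- `d'` by `d` inside `B`.
  set κ : ℝ := 1 + ‖B‖ * R with hκ
  have hκ0 : 0 ≤ κ := by positivity
  set L : ℕ → Set E := fun n => {x | ∃ d' ∈ Metric.closedBall d (1 / ((n : ℝ) + 1)), (x, d') ∈ F ∧
    σ - κ * (1 / ((n : ℝ) + 1)) ≤ B x d} with hL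
  obtain ⟨x, hx⟩ := Antitone.exists_forall_mem_of_convex
    (C := fun n => closure (L n))
    (fun n k hnk => closure_mono fun x ⟨d', hd', hF, h⟩ =>
      ⟨d', Metric.closedBall_subset_closedBall (by gcongr) hd', hF, le_trans (by gcongr) h⟩)
    (fun n => by
      obtain ⟨d', ⟨x, hF, h⟩, hdd⟩ := Metric.mem_closure_iff.1 (hd n) (1 / ((n : ℝ) + 1))
        Nat.one_div_pos_of_nat
      refine ⟨x, subset_closure ⟨d', by rw [Metric.mem_closedBall, dist_comm]; exact hdd.le, hF, ?_⟩⟩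
      have h1 : B x (d' - d) ≤ ‖B‖ * R * (1 / ((n : ℝ) + 1)) := by
        refine (le_abs_self _).trans ((B.le_opNorm₂ _ _).trans ?_)
        rw [dist_comm, dist_eq_norm] at hdd
        have := (norm_fst_le _).trans (hR _ hF)
        gcongr
      rw [map_sub] at h1
      rw [hκ, add_mul]
      linarith)
    (fun n => isClosed_closure)
    (fun n => by
      refine Convex.closure ?_
      rintro x₁ ⟨d₁, hd₁, hF₁, h₁⟩ x₂ ⟨d₂, hd₂, hF₂, h₂⟩ a b ha hb hab
      refine ⟨a • d₁ + b • d₂, convex_closedBall _ _ hd₁ hd₂ ha hb hab, hconv hF₁ hF₂ ha hb hab, ?_⟩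
      simp only [map_add, map_smul, add_apply, smul_apply,
        smul_eq_mul]
      set e := σ - κ * (1 / ((n : ℝ) + 1))
      calc e = a * e + b * e := by rw [← add_mul, hab, one_mul]
        _ ≤ _ := by gcongr)
    (R := R)
    (fun x hx => by
      have : closure (L 0) ⊆ {x | ‖x‖ ≤ R} :=
        closure_minimal (fun x ⟨d', _, hF, _⟩ => (norm_fst_le (x, d')).trans (hR _ hF))
          (isClosed_le continuous_norm continuous_const)
      exact this hx)
  have happrox : ∀ n, ∃ x' ∈ L n, dist x x' < 1 / ((n : ℝ) + 1) := fun n =>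
    Metric.mem_closure_iff.1 (hx n) _ Nat.one_div_pos_of_nat
  choose x' hx' hxx using happrox
  choose d' hd' hF' hB' using hx'
  have hlimx : Tendsto x' atTop (𝓝 x) := by
    rw [tendsto_iff_dist_tendsto_zero]
    exact squeeze_zero (fun _ => dist_nonneg) (fun n => by rw [dist_comm]; exact (hxx n).le) hε
  have hlimd : Tendsto d' atTop (𝓝 d) := by
    rw [tendsto_iff_dist_tendsto_zero]
    exact squeeze_zero (fun _ => dist_nonneg) hd' hε
  refine ⟨(x, d), hclosed.mem_of_tendsto (hlimx.prodMk_nhds hlimd) (Eventually.of_forall hF'),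
    fun w hw => ?_⟩
  have h1 : σ - κ * 0 ≤ B x d := le_of_tendsto_of_tendsto'
    (tendsto_const_nhds.sub (hε.const_mul κ))
    ((hJc.tendsto (x, d)).comp (hlimx.prodMk_nhds tendsto_const_nhds)) hB'
  have h2 : J w ≤ σ := le_csSup hbdd (mem_image_of_mem J hw)
  simp only [hJ] at h2
  simp only
  linarith

/-! ### Integral functionals and pointwise constraints on `L²`. -/

section

variable {α : Type*} [MeasurableSpace α] {μ : Measure α}

/-- A measurable weight with values in `[0, W]` defines a bounded bilinear form on `L²`. -/
theorem exists_bilinear_eq_integral_weight {w : α → ℝ} (hw : AEStronglyMeasurable w μ) {W : ℝ}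
    (hwW : ∀ᵐ t ∂μ, |w t| ≤ W) :
    ∃ B : Lp ℝ 2 μ →L[ℝ] Lp ℝ 2 μ →L[ℝ] ℝ, ∀ x d, B x d = ∫ t, w t * (x t * d t) ∂μ := by
  have hmem : ∀ d : Lp ℝ 2 μ, MemLp (fun t => w t * d t) 2 μ := fun d =>
    (Lp.memLp d).of_le_mul (c := W) (hw.mul (Lp.aestronglyMeasurable d)) (by
      filter_upwards [hwW] with t ht
      rw [norm_mul]
      gcongr
      exact ht)
  let T : Lp ℝ 2 μ →L[ℝ] Lp ℝ 2 μ := LinearMap.mkContinuous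
    ({
      toFun := fun d => MemLp.toLp (fun t => w t * d t) (hmem d)
      map_add' := fun d e => by
        apply Lp.ext
        filter_upwards [(hmem (d + e)).coeFn_toLp, (hmem d).coeFn_toLp, (hmem e).coeFn_toLp,
          Lp.coeFn_add d e, Lp.coeFn_add (hmem d).toLp (hmem e).toLp] with t h1 h2 h3 h4 h5
        rw [h1, h5, Pi.add_apply, h2, h3, h4, Pi.add_apply, mul_add]
      map_smul' := fun c d => by
        apply Lp.ext
        filter_upwards [(hmem (c • d)).coeFn_toLp, (hmem d).coeFn_toLp,
          Lp.coeFn_smul c d, Lp.coeFn_smul c (hmem d).toLp] with t h1 h2 h3 h4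
        simp only [RingHom.id_apply]
        rw [h1, h4, Pi.smul_apply, h2, h3, Pi.smul_apply, smul_eq_mul, smul_eq_mul]
        ring } : Lp ℝ 2 μ →ₗ[ℝ] Lp ℝ 2 μ) W (fun d => Lp.norm_le_mul_norm_of_ae_le_mul (by
          filter_upwards [(hmem d).coeFn_toLp, hwW] with t h1 h2
          change ‖MemLp.toLp _ (hmem d) t‖ ≤ _
          rw [h1, norm_mul]
          gcongr
          exact h2))
  -- With `T` the multiplication by `w`, this is the form `⟨x, T d⟩`.
  refine ⟨(ContinuousLinearMap.compL ℝ _ _ _).flip T ∘L innerSL ℝ, fun x d => ?_⟩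
  change inner ℝ x (hmem d).toLp = _
  rw [L2.inner_def]
  refine integral_congr_ae ?_
  filter_upwards [(hmem d).coeFn_toLp] with t h1
  rw [h1]
  simp only [RCLike.inner_apply, conj_trivial]
  ring

/-- On a finite measure space the integral is continuous on `L²`. -/
theorem continuous_integral_Lp_two [IsFiniteMeasure μ] :
    Continuous fun d : Lp ℝ 2 μ => ∫ t, d t ∂μ := by
  have h1 : MemLp (fun _ : α => (1 : ℝ)) 2 μ := memLp_const 1
  have : (fun d : Lp ℝ 2 μ => ∫ t, d t ∂μ) = fun d => inner ℝ h1.toLp d := by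
    funext d
    rw [L2.inner_def]
    refine integral_congr_ae ?_
    filter_upwards [h1.coeFn_toLp] with t ht
    rw [ht]
    simp
  rw [this]
  exact continuous_const.inner continuous_id

/-- The pairs of `L²` functions whose values lie in prescribed closed sets form a closed set. -/
theorem isClosed_setOf_ae_prodMk_mem {C : α → Set (ℝ × ℝ)} (hC : ∀ᵐ t ∂μ, IsClosed (C t)) :
    IsClosed {v : Lp ℝ 2 μ × Lp ℝ 2 μ | ∀ᵐ t ∂μ, (v.1 t, v.2 t) ∈ C t} := by
  refine IsSeqClosed.isClosed fun u v hu huv => ?_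
  have h1 : Tendsto (fun n => (u n).1) atTop (𝓝 v.1) := (continuous_fst.tendsto v).comp huv
  have h2 : Tendsto (fun n => (u n).2) atTop (𝓝 v.2) := (continuous_snd.tendsto v).comp huv
  -- Norm convergence gives a.e. convergence along a subsequence, extracted for one coordinate after
  -- the other.
  obtain ⟨φ, hφ, hφt⟩ := (tendstoInMeasure_of_tendsto_Lp h1).exists_seq_tendsto_ae
  obtain ⟨χ, hχ, hχt⟩ :=
    (tendstoInMeasure_of_tendsto_Lp (h2.comp hφ.tendsto_atTop)).exists_seq_tendsto_ae
  have hall : ∀ᵐ t ∂μ, ∀ n, ((u n).1 t, (u n).2 t) ∈ C t := ae_all_iff.2 hu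
  filter_upwards [hC, hφt, hχt, hall] with t hCt h3 h4 h5
  exact hCt.mem_of_tendsto ((h3.comp hχ.tendsto_atTop).prodMk_nhds h4)
    (Eventually.of_forall fun n => h5 (φ (χ n)))

/-- The pairs of `L²` functions whose values lie in prescribed convex sets form a convex set. -/
theorem convex_setOf_ae_prodMk_mem {C : α → Set (ℝ × ℝ)} (hC : ∀ᵐ t ∂μ, Convex ℝ (C t)) :
    Convex ℝ {v : Lp ℝ 2 μ × Lp ℝ 2 μ | ∀ᵐ t ∂μ, (v.1 t, v.2 t) ∈ C t} := by
  intro u hu v hv a b ha hb hab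
  filter_upwards [hC, hu, hv, Lp.coeFn_add (a • u.1) (b • v.1), Lp.coeFn_add (a • u.2) (b • v.2),
    Lp.coeFn_smul a u.1, Lp.coeFn_smul b v.1, Lp.coeFn_smul a u.2, Lp.coeFn_smul b v.2]
    with t hCt h1 h2 h3 h4 h5 h6 h7 h8
  have := hCt h1 h2 ha hb hab
  change ((a • u.1 + b • v.1 : Lp ℝ 2 μ) t, (a • u.2 + b • v.2 : Lp ℝ 2 μ) t) ∈ C t
  rw [h3, h4, Pi.add_apply, Pi.add_apply, h5, h6, h7, h8]
  exact this

theorem integrable_weight_mul {w : α → ℝ} (hw : AEStronglyMeasurable w μ) {W : ℝ}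
    (hwW : ∀ᵐ t ∂μ, |w t| ≤ W) (x d : Lp ℝ 2 μ) :
    Integrable (fun t => w t * (x t * d t)) μ :=
  ((Lp.memLp x).integrable_mul (Lp.memLp d)).bdd_mul (c := W) hw hwW

/-- Maximization of a weighted integral of `x * d` over pairs `(x, d)` of `L²` functions with values
in convex sets that are downward closed in the second coordinate. -/
theorem exists_max_integral_weight_mul [IsFiniteMeasure μ] {w : α → ℝ}
    (hw : AEStronglyMeasurable w μ) {W : ℝ} (hwW : ∀ᵐ t ∂μ, |w t| ≤ W) (hw0 : ∀ t, 0 < w t)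
    {C : α → Set (ℝ × ℝ)} (hclosed : ∀ᵐ t ∂μ, IsClosed (C t)) (hconv : ∀ᵐ t ∂μ, Convex ℝ (C t))
    {δ : ℝ} (hδ : 0 < δ) (hge : ∀ᵐ t ∂μ, ∀ x d, (x, d) ∈ C t → δ ≤ d)
    (hdown : ∀ᵐ t ∂μ, ∀ x d d', (x, d) ∈ C t → δ ≤ d' → d' ≤ d → (x, d') ∈ C t)
    {H : α → ℝ} (hH : MemLp H 2 μ)
    (hbound : ∀ᵐ t ∂μ, ∀ x d, (x, d) ∈ C t → |x| ≤ H t ∧ |d| ≤ H t) (k : ℝ)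
    {F : Set (Lp ℝ 2 μ × Lp ℝ 2 μ)}
    (hF : F = {v | (∀ᵐ t ∂μ, (v.1 t, v.2 t) ∈ C t) ∧ ∫ t, v.2 t ∂μ = k}) (hne : F.Nonempty) :
    ∃ v ∈ F, ∀ u ∈ F, ∫ t, w t * (u.1 t * u.2 t) ∂μ ≤ ∫ t, w t * (v.1 t * v.2 t) ∂μ := by
  obtain ⟨B, hB⟩ := exists_bilinear_eq_integral_weight hw hwW
  have hFclosed : IsClosed F := by
    rw [hF]
    exact (isClosed_setOf_ae_prodMk_mem hclosed).inter
      (isClosed_singleton.preimage (continuous_integral_Lp_two.comp continuous_snd))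
  have hFconv : Convex ℝ F := by
    rw [hF]
    refine (convex_setOf_ae_prodMk_mem hconv).inter ?_
    intro u hu v hv a b ha hb hab
    have hint : ∀ d : Lp ℝ 2 μ, Integrable d μ := fun d => (Lp.memLp d).integrable (by norm_num)
    have h1 : ∫ t, (a • u.2 + b • v.2 : Lp ℝ 2 μ) t ∂μ
        = a * ∫ t, u.2 t ∂μ + b * ∫ t, v.2 t ∂μ := by
      rw [← integral_const_mul, ← integral_const_mul,
        ← integral_add ((hint _).const_mul _) ((hint _).const_mul _)]
      refine integral_congr_ae ?_
      filter_upwards [Lp.coeFn_add (a • u.2) (b • v.2), Lp.coeFn_smul a u.2, Lp.coeFn_smul b v.2]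
        with t h1 h2 h3
      rw [h1, Pi.add_apply, h2, h3]
      rfl
    have h2 : ∫ t, u.2 t ∂μ = k := hu
    have h3 : ∫ t, v.2 t ∂μ = k := hv
    change ∫ t, (a • u.2 + b • v.2 : Lp ℝ 2 μ) t ∂μ = k
    rw [h1, h2, h3, ← add_mul, hab, one_mul]
  have hFbdd : ∀ v ∈ F, ‖v‖ ≤ ‖hH.toLp‖ := by
    intro v hv
    rw [hF] at hv
    rw [norm_prod_le_iff]
    constructor
    · refine Lp.norm_le_norm_of_ae_le ?_
      filter_upwards [hbound, hv.1, hH.coeFn_toLp] with t h1 h2 h3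
      rw [h3, Real.norm_eq_abs]
      exact (h1 _ _ h2).1.trans (le_abs_self _)
    · refine Lp.norm_le_norm_of_ae_le ?_
      filter_upwards [hbound, hv.1, hH.coeFn_toLp] with t h1 h2 h3
      rw [h3, Real.norm_eq_abs]
      exact (h1 _ _ h2).2.trans (le_abs_self _)
  -- For fixed `d` there is a largest admissible `x`, and it is antitone in `d`.
  have hbest : ∀ x d, (x, d) ∈ F → ∃ y, (y, d) ∈ F ∧ B x d ≤ B y d ∧
      ∀ x' d', (x', d') ∈ F → ∀ᵐ t ∂μ, d t ≤ d' t → x' t ≤ y t := by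
    intro x d hxd
    -- A maximizer of the linear functional `B · d` on the slice over `d` serves as the largest
    -- price; the comparison with `x'` follows by raising `y` to `max x' y` on the set where `d ≤
    -- d'`.
    obtain ⟨y, hy, hmax⟩ := (B.flip d).exists_isMaxOn_of_convex (A := {x | (x, d) ∈ F}) ⟨x, hxd⟩
      (hFclosed.preimage (by fun_prop))
      (by
        intro x₁ h₁ x₂ h₂ a b ha hb hab
        have := hFconv h₁ h₂ ha hb hab
        simpa [← add_smul, hab] using this)
      (R := ‖hH.toLp‖) (fun x hx => (norm_fst_le (x, d)).trans (hFbdd _ hx))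
    refine ⟨y, hy, hmax hxd, fun x' d' hxd' => ?_⟩
    classical
    have hmeas : NullMeasurableSet {t | d t ≤ d' t} μ :=
      nullMeasurableSet_le (Lp.aestronglyMeasurable d).aemeasurable
        (Lp.aestronglyMeasurable d').aemeasurable
    set e : Lp ℝ 2 μ := x' ⊔ y - y with he
    -- The set is only known to be null-measurable, and its measurable hull agrees with it a.e.
    set A := toMeasurable μ {t | d t ≤ d' t} with hA
    have hAae : ∀ᵐ t ∂μ, (t ∈ A ↔ d t ≤ d' t) := by
      filter_upwards [hmeas.toMeasurable_ae_eq.mem_iff] with t ht using ht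
    have hzm : MemLp (A.indicator e) 2 μ := (Lp.memLp e).indicator (measurableSet_toMeasurable _ _)
    set z : Lp ℝ 2 μ := y + hzm.toLp with hz
    have hzt : ∀ᵐ t ∂μ, z t = if d t ≤ d' t then max (x' t) (y t) else y t := by
      filter_upwards [Lp.coeFn_add y hzm.toLp, hzm.coeFn_toLp, Lp.coeFn_sub (x' ⊔ y) y,
        Lp.coeFn_sup x' y, hAae] with t h1 h2 h3 h4 h5
      rw [h1, Pi.add_apply, h2, indicator_apply]
      simp only [h5]
      split_ifs
      · rw [he, h3, Pi.sub_apply, h4, Pi.sup_apply]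
        simp
      · simp
    have hzF : (z, d) ∈ F := by
      rw [hF] at hy hxd' ⊢
      refine ⟨?_, hy.2⟩
      filter_upwards [hzt, hy.1, hxd'.1, hdown, hge] with t h1 h2 h3 h4 h5
      simp only [h1] at h2 h3 ⊢
      split_ifs with h
      · rcases le_total (x' t) (y t) with h' | h'
        · rwa [max_eq_right h']
        · rw [max_eq_left h']
          -- The price `x' t` is admissible with demand `d' t`, hence also with the smaller demand
          -- `d t`.
          exact h4 _ _ _ h3 (h5 _ _ h2) h
      · exact h2
    have hle : B z d ≤ B y d := hmax hzF
    rw [hB, hB] at hle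
    have hd0 : ∀ᵐ t ∂μ, 0 < d t := by
      rw [hF] at hxd
      filter_upwards [hxd.1, hge] with t h1 h2
      exact hδ.trans_le (h2 _ _ h1)
    have hyz : ∀ᵐ t ∂μ, y t ≤ z t := by
      filter_upwards [hzt] with t h1
      rw [h1]
      split_ifs
      · exact le_max_right _ _
      · exact le_rfl
    have hmono : (fun t => w t * (y t * d t)) ≤ᵐ[μ] fun t => w t * (z t * d t) := by
      filter_upwards [hd0, hyz] with t h1 h2
      have := hw0 t
      gcongr
    -- Since `z ≥ y`, maximality forces equal integrals, and positivity of `w` and `d` then gives `z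
    -- = y` a.e.
    have heq := (integral_eq_iff_of_ae_le (integrable_weight_mul hw hwW y d)
      (integrable_weight_mul hw hwW z d) hmono).1 (le_antisymm (integral_mono_ae
        (integrable_weight_mul hw hwW y d) (integrable_weight_mul hw hwW z d) hmono) hle)
    filter_upwards [heq, hd0, hzt] with t h1 h2 h3 h4
    have h5 := mul_right_cancel₀ h2.ne' (mul_left_cancel₀ (hw0 t).ne' h1)
    rw [h5, h3, if_pos h4]
    exact le_max_left _ _
  obtain ⟨v, hv, hmax⟩ := exists_isMaxOn_bilinear B hne hFclosed hFconv hFbdd (by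
    rintro c d₁ ⟨x₁, hF₁, hc₁⟩ d₂ ⟨x₂, hF₂, hc₂⟩ a b ha hb hab
    obtain ⟨y₁, hy₁, hB₁, hy₁'⟩ := hbest x₁ d₁ hF₁
    obtain ⟨y₂, hy₂, hB₂, hy₂'⟩ := hbest x₂ d₂ hF₂
    refine ⟨a • y₁ + b • y₂, hFconv hy₁ hy₂ ha hb hab, ?_⟩
    -- For `a + b = 1`, the value of `B` at the combined pair is `a * B y₁ d₁ + b * B y₂ d₂ - a * b
    -- * B (y₁ - y₂) (d₁ - d₂)`, so a nonpositive cross term keeps it at least `c`.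
    have hcross : B (y₁ - y₂) (d₁ - d₂) ≤ 0 := by
      rw [hB]
      refine integral_nonpos_of_ae ?_
      filter_upwards [hy₁' _ _ hy₂, hy₂' _ _ hy₁, Lp.coeFn_sub y₁ y₂, Lp.coeFn_sub d₁ d₂]
        with t h1 h2 h3 h4
      rw [h3, h4]
      refine mul_nonpos_of_nonneg_of_nonpos (hw0 t).le ?_
      simp only [Pi.sub_apply]
      rcases le_total (d₁ t) (d₂ t) with h | h
      · exact mul_nonpos_of_nonneg_of_nonpos (sub_nonneg.2 (h1 h)) (sub_nonpos.2 h)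
      · exact mul_nonpos_of_nonpos_of_nonneg (sub_nonpos.2 (h2 h)) (sub_nonneg.2 h)
    obtain rfl : b = 1 - a := by linarith
    simp only [map_add, map_sub, map_smul, add_apply, sub_apply, smul_apply, smul_eq_mul]
      at hcross ⊢
    nlinarith [mul_nonneg ha hb, mul_le_mul_of_nonneg_left (hc₁.trans hB₁) ha,
      mul_le_mul_of_nonneg_left (hc₂.trans hB₂) hb,
      mul_nonneg (mul_nonneg ha hb) (neg_nonneg.2 hcross)])
  exact ⟨v, hv, fun u hu => by simpa only [hB] using hmax u hu⟩

end

/-! ### Affine dependence on the parameter and the robust counterpart. -/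

/-- A function on a convex set with nonempty interior whose second derivative vanishes is
affine. -/
theorem Convex.eq_add_fderivWithin_of_fderivWithin_fderivWithin_eq_zero {E : Type*}
    [NormedAddCommGroup E] [NormedSpace ℝ E] {f : E → ℝ} {s : Set E} (hs : Convex ℝ s)
    (hsi : (interior s).Nonempty) (hf : ContDiffOn ℝ 2 f s)
    (h0 : ∀ x ∈ s, fderivWithin ℝ (fderivWithin ℝ f s) s x = 0) {x y : E} (hx : x ∈ s)
    (hy : y ∈ s) : f y = f x + fderivWithin ℝ f s x (y - x) := by
  have hu : UniqueDiffOn ℝ s := uniqueDiffOn_convex hs hsi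
  have hd : DifferentiableOn ℝ (fderivWithin ℝ f s) s :=
    (hf.fderivWithin hu (m := 1) (by norm_num)).differentiableOn (by norm_num)
  have hconst : ∀ z ∈ s, fderivWithin ℝ f s z = fderivWithin ℝ f s x := fun z hz =>
    hs.is_const_of_fderivWithin_eq_zero hd h0 hz hx
  set L := fderivWithin ℝ f s x
  have hfd : DifferentiableOn ℝ f s := hf.differentiableOn (by norm_num)
  have key := hs.is_const_of_fderivWithin_eq_zero (f := fun z => f z - L z)
    (hfd.sub L.differentiable.differentiableOn) (fun z hz => by
      rw [fderivWithin_fun_sub (hu z hz) (hfd z hz) L.differentiableAt.differentiableWithinAt,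
        L.fderivWithin (hu z hz), hconst z hz, sub_self]) hx hy
  rw [map_sub]
  linarith

namespace PricingModel

variable {S : Type*} {m : ℕ}

theorem U_eq_closedBall (M : PricingModel S m) (s : S) :
    M.U s = Metric.closedBall (M.ξ₀ s) M.τ := by
  have hτ := M.τ_pos
  ext ξ
  rw [Metric.mem_closedBall, dist_eq_norm]
  constructor
  · rintro ⟨ψ, hψ, rfl⟩
    rw [add_sub_cancel_left, norm_smul, Real.norm_of_nonneg hτ.le]
    exact mul_le_of_le_one_right hτ.le hψ
  · intro h
    refine ⟨M.τ⁻¹ • (ξ - M.ξ₀ s), ?_, ?_⟩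
    · rw [norm_smul, norm_inv, Real.norm_of_nonneg hτ.le]
      exact inv_mul_le_one_of_le₀ h hτ.le
    · rw [smul_inv_smul₀ hτ.ne', add_sub_cancel]

theorem ξ₀_mem_U (M : PricingModel S m) (s : S) : M.ξ₀ s ∈ M.U s :=
  ⟨0, by simp, by simp⟩

variable [DecidableEq S]

/-- The robust counterpart of a demand constraint: it holds iff the constraint holds for all
parameters of the uncertainty set. -/
theorem Regular.robust_iff {M : PricingModel S m} (hM : M.Regular) (s : S) {t : ℝ}
    (ht : t ∈ Icc M.t₀ M.t_f) {p : S → ℝ} (hp : p ∈ M.priceBox) (d : ℝ) :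
    d - M.h s t p (M.ξ₀ s) + M.τ * ‖M.demandGradient s t p (M.ξ₀ s)‖ ≤ 0 ↔
      ∀ ξ ∈ M.U s, d ≤ M.h s t p ξ := by
  have hτ := M.τ_pos
  obtain ⟨hC, h0⟩ := hM.linear_param s t ht p hp
  have hint : (interior (M.U s)).Nonempty := by
    rw [M.U_eq_closedBall]
    exact ⟨M.ξ₀ s, Metric.ball_subset_interior_closedBall (Metric.mem_ball_self hτ)⟩
  have hconv : Convex ℝ (M.U s) := by
    rw [M.U_eq_closedBall]
    exact convex_closedBall _ _
  set g := M.demandGradient s t p (M.ξ₀ s) with hg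
  have haff : ∀ ψ : M.Param, ‖ψ‖ ≤ 1 →
      M.h s t p (M.ξ₀ s + M.τ • ψ) = M.h s t p (M.ξ₀ s) + M.τ * inner ℝ g ψ := by
    intro ψ hψ
    rw [hconv.eq_add_fderivWithin_of_fderivWithin_fderivWithin_eq_zero hint hC h0 (M.ξ₀_mem_U s)
      ⟨ψ, hψ, rfl⟩, add_sub_cancel_left, map_smul, smul_eq_mul, hg, demandGradient,
      gradientWithin, InnerProductSpace.toDual_symm_apply]
  constructor
  · rintro h ξ ⟨ψ, hψ, rfl⟩
    rw [haff ψ hψ]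
    have h1 : -‖g‖ ≤ inner ℝ g ψ := by
      have := neg_le_of_abs_le (abs_real_inner_le_norm g ψ)
      nlinarith [norm_nonneg g]
    nlinarith
  · intro h
    -- This is the worst-case direction; for `g = 0` it degenerates to `0`, which is harmless.
    have hn : ‖-(‖g‖⁻¹ • g)‖ ≤ 1 := by
      rw [norm_neg, norm_smul, norm_inv, norm_norm]
      exact inv_mul_le_one_of_le₀ le_rfl (norm_nonneg _)
    have h1 := h _ ⟨_, hn, rfl⟩
    rw [haff _ hn, inner_neg_right, inner_smul_right, real_inner_self_eq_norm_sq] at h1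
    have h2 : ‖g‖⁻¹ * ‖g‖ ^ 2 = ‖g‖ := by
      rcases eq_or_ne ‖g‖ 0 with h | h
      · simp [h]
      · field_simp
    rw [h2] at h1
    linarith

/-! ### The pointwise constraint sets of the pricing model. -/

/-- The pairs of a price of seller `s` and a realized demand that satisfy, at the time `t`, the
constraints of the robust best response problem against the competitors' prices `q`. -/
def robustSection (M : PricingModel S m) (s : S) (q : S → ℝ) (t : ℝ) : Set (ℝ × ℝ) :=
  {v | v.1 ∈ Icc M.priceMin M.priceMax ∧ M.demandMin ≤ v.2 ∧
    ∀ ξ ∈ M.U s, v.2 ≤ M.h s t (Function.update q s v.1) ξ}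

variable {M : PricingModel S m} {s : S} {t : ℝ} {q : S → ℝ}

theorem update_mem_priceBox (hq : ∀ r ≠ s, q r ∈ Icc M.priceMin M.priceMax) {x : ℝ}
    (hx : x ∈ Icc M.priceMin M.priceMax) : Function.update q s x ∈ M.priceBox := by
  intro r
  rcases eq_or_ne r s with rfl | h
  · simpa using hx
  · simpa [h] using hq r h

theorem update_convex_combination (q : S → ℝ) (s : S) (x y : ℝ) {a b : ℝ} (hab : a + b = 1) :
    Function.update q s (a • x + b • y) = a • Function.update q s x + b • Function.update q s y := by
  funext r
  rcases eq_or_ne r s with rfl | h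
  · simp
  · simp [h, ← add_mul, hab]

theorem Regular.concaveOn_ownPrice (hM : M.Regular) (ht : t ∈ Icc M.t₀ M.t_f)
    (hq : ∀ r ≠ s, q r ∈ Icc M.priceMin M.priceMax) {ξ : M.Param} (hξ : ξ ∈ M.U s) :
    ConcaveOn ℝ (Icc M.priceMin M.priceMax) fun x => M.h s t (Function.update q s x) ξ := by
  refine ⟨convex_Icc _ _, fun x hx y hy a b ha hb hab => ?_⟩
  have := (hM.concaveOn s t ht ξ hξ).2 (update_mem_priceBox hq hx) (update_mem_priceBox hq hy)
    ha hb hab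
  rwa [← update_convex_combination q s x y hab] at this

theorem Regular.convex_robustSection (hM : M.Regular) (ht : t ∈ Icc M.t₀ M.t_f)
    (hq : ∀ r ≠ s, q r ∈ Icc M.priceMin M.priceMax) : Convex ℝ (M.robustSection s q t) := by
  rintro ⟨x, d⟩ ⟨hx, hd, hxd⟩ ⟨y, e⟩ ⟨hy, he, hye⟩ a b ha hb hab
  refine ⟨convex_Icc _ _ hx hy ha hb hab, convex_Ici (𝕜 := ℝ) M.demandMin hd he ha hb hab, fun ξ hξ => ?_⟩
  refine le_trans ?_ ((hM.concaveOn_ownPrice ht hq hξ).2 hx hy ha hb hab)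
  exact add_le_add (mul_le_mul_of_nonneg_left (hxd ξ hξ) ha)
    (mul_le_mul_of_nonneg_left (hye ξ hξ) hb)

theorem Regular.isClosed_robustSection (hM : M.Regular) (ht : t ∈ Icc M.t₀ M.t_f)
    (hq : ∀ r ≠ s, q r ∈ Icc M.priceMin M.priceMax) : IsClosed (M.robustSection s q t) := by
  refine IsSeqClosed.isClosed fun u v hu huv => ?_
  have h1 : Tendsto (fun n => (u n).1) atTop (𝓝 v.1) := (continuous_fst.tendsto v).comp huv
  have h2 : Tendsto (fun n => (u n).2) atTop (𝓝 v.2) := (continuous_snd.tendsto v).comp huv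
  have hv : v.1 ∈ Icc M.priceMin M.priceMax :=
    isClosed_Icc.mem_of_tendsto h1 (Eventually.of_forall fun n => (hu n).1)
  refine ⟨hv, ge_of_tendsto' h2 fun n => (hu n).2.1, fun ξ hξ => ?_⟩
  have hc := hM.continuousOn s t ht ξ hξ _ (update_mem_priceBox hq hv)
  have h3 : Tendsto (fun n => Function.update q s (u n).1) atTop
      (𝓝[M.priceBox] Function.update q s v.1) := by
    refine tendsto_nhdsWithin_iff.2 ⟨?_, Eventually.of_forall fun n =>
      update_mem_priceBox hq (hu n).1⟩
    have hcu : Continuous fun x => Function.update q s x := continuous_const.update s continuous_id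
    exact (hcu.tendsto v.1).comp h1
  exact le_of_tendsto_of_tendsto' h2 (hc.tendsto.comp h3) fun n => (hu n).2.2 ξ hξ

/-- A bound for the demand that depends only on the demands at the extremal own prices and at their
midpoint. -/
theorem Regular.demand_le (hM : M.Regular) (ht : t ∈ Icc M.t₀ M.t_f)
    (hq : ∀ r ≠ s, q r ∈ Icc M.priceMin M.priceMax) {ξ : M.Param} (hξ : ξ ∈ M.U s) {x : ℝ}
    (hx : x ∈ Icc M.priceMin M.priceMax) :
    M.h s t (Function.update q s x) ξ ≤ |M.h s t (Function.update q s M.priceMin) ξ|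
      + |M.h s t (Function.update q s M.priceMax) ξ|
      + 2 * |M.h s t (Function.update q s ((M.priceMin + M.priceMax) / 2)) ξ| := by
  have hc := hM.concaveOn_ownPrice ht hq hξ
  set f : ℝ → ℝ := fun x => M.h s t (Function.update q s x) ξ with hf
  change f x ≤ |f M.priceMin| + |f M.priceMax| + 2 * |f ((M.priceMin + M.priceMax) / 2)|
  have hle : M.priceMin ≤ M.priceMax := hx.1.trans hx.2
  have hy : M.priceMin + M.priceMax - x ∈ Icc M.priceMin M.priceMax :=
    ⟨by linarith [hx.2], by linarith [hx.1]⟩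
  have h1 := hc.2 hx hy (by norm_num : (0 : ℝ) ≤ 1 / 2) (by norm_num : (0 : ℝ) ≤ 1 / 2) (by norm_num)
  simp only [smul_eq_mul] at h1
  rw [show 1 / 2 * x + 1 / 2 * (M.priceMin + M.priceMax - x)
    = (M.priceMin + M.priceMax) / 2 by ring] at h1
  have h2 := hc.min_le_of_mem_Icc (left_mem_Icc.2 hle) (right_mem_Icc.2 hle) hy
  have h3 : -(|f M.priceMin| + |f M.priceMax|) ≤ min (f M.priceMin) (f M.priceMax) :=
    le_min (by linarith [neg_abs_le (f M.priceMin), abs_nonneg (f M.priceMax)])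
      (by linarith [neg_abs_le (f M.priceMax), abs_nonneg (f M.priceMin)])
  have h4 := le_abs_self (f ((M.priceMin + M.priceMax) / 2))
  linarith

/-- The demand at a constant own price is square integrable. -/
theorem Regular.memLp_constant_ownPrice (hM : M.Regular) {π : S → M.Path}
    (hπ : ∀ r ≠ s, M.FeasiblePrice (π r)) {ξ : M.Param} (hξ : ξ ∈ M.U s) {x : ℝ}
    (hx : x ∈ Icc M.priceMin M.priceMax) :
    MemLp (fun t => M.h s t (Function.update (fun r => π r t) s x) ξ) 2 M.μ := by
  have hxm : MemLp (fun _ => x) 2 M.μ := memLp_const x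
  refine (hM.memLp s (Function.update π s hxm.toLp) (fun r => ?_) ξ hξ).ae_eq ?_
  · rcases eq_or_ne r s with rfl | h
    · rw [Function.update_self]
      filter_upwards [hxm.coeFn_toLp] with t ht
      rw [ht]
      exact hx
    · rw [Function.update_of_ne h]
      exact hπ r h
  · filter_upwards [hxm.coeFn_toLp] with t ht
    rw [demandPath]
    congr 1
    funext r
    rcases eq_or_ne r s with rfl | h
    · simp only [Function.update_self, ht]
    · simp [h]

theorem update_path_apply (π : S → M.Path) (s : S) (x : M.Path) (t : ℝ) :
    (fun r => Function.update π s x r t) = Function.update (fun r => π r t) s (x t) := by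
  funext r
  rcases eq_or_ne r s with rfl | h
  · simp
  · simp [h]

/-- The robust strategy space is described by the pointwise constraint sets. -/
theorem Regular.robustStrategySpace_eq [Finite S] (hM : M.Regular) {π : S → M.Path}
    (hπ : ∀ r ≠ s, M.FeasiblePrice (π r)) :
    M.robustStrategySpace s π = {v | (∀ᵐ t ∂M.μ, (v.1 t, v.2 t) ∈
      M.robustSection s (fun r => π r t) t) ∧ ∫ t, v.2 t ∂M.μ = M.K s} := by
  have hbox : ∀ᵐ t ∂M.μ, ∀ r ≠ s, π r t ∈ Icc M.priceMin M.priceMax :=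
    ae_all_iff.2 fun r => by
      rcases eq_or_ne r s with h | h
      · exact Eventually.of_forall fun t h' => absurd h h'
      · filter_upwards [hπ r h] with t ht _ using ht
  have hmem : ∀ᵐ t ∂M.μ, t ∈ Icc M.t₀ M.t_f := ae_restrict_mem measurableSet_Icc
  ext v
  constructor
  · rintro ⟨h1, h2, h3, h4, h5⟩
    refine ⟨?_, h2.symm⟩
    filter_upwards [h1, h3, h4, h5, hbox, hmem] with t h1 h3 h4 h5 hb ht
    refine ⟨⟨h3, h4⟩, h5, ?_⟩
    rw [demandPath, update_path_apply] at h1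
    exact (hM.robust_iff s ht (update_mem_priceBox hb ⟨h3, h4⟩) _).1 h1
  · rintro ⟨h1, h2⟩
    refine ⟨?_, h2.symm, h1.mono fun t h => h.1.1, h1.mono fun t h => h.1.2,
      h1.mono fun t h => h.2.1⟩
    filter_upwards [h1, hbox, hmem] with t h1 hb ht
    rw [demandPath, update_path_apply]
    exact (hM.robust_iff s ht (update_mem_priceBox hb h1.1) _).2 h1.2.2

end PricingModel

/-! ### Existence of a robust best response. -/

theorem theorem4 {S : Type*} [Fintype S] [DecidableEq S] {m : ℕ} (M : PricingModel S m)
    (hM : M.Regular) (s : S) (π : S → M.Path) (hπ : ∀ r ≠ s, M.FeasiblePrice (π r))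
    (hne : (M.robustStrategySpace s π).Nonempty) :
    ∃ v : M.Path × M.Path, M.IsRobustBestResponse s π v := by
  have hbox : ∀ᵐ t ∂M.μ, ∀ r ≠ s, π r t ∈ Icc M.priceMin M.priceMax :=
    ae_all_iff.2 fun r => by
      rcases eq_or_ne r s with h | h
      · exact Eventually.of_forall fun t h' => absurd h h'
      · filter_upwards [hπ r h] with t ht _ using ht
  have hmem : ∀ᵐ t ∂M.μ, t ∈ Icc M.t₀ M.t_f := ae_restrict_mem measurableSet_Icc
  -- The order of the price bounds comes from a feasible price path, since the horizon has positive
  -- measure.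
  have hle : M.priceMin ≤ M.priceMax := by
    obtain ⟨v, -, -, h3, h4, -⟩ := hne
    have : NeBot (ae M.μ) := by
      rw [ae_neBot, Ne, Measure.restrict_eq_zero, Real.volume_Icc, ENNReal.ofReal_eq_zero, not_le,
        sub_pos]
      exact M.t₀_lt_t_f
    obtain ⟨t, h3, h4⟩ := (h3.and h4).exists
    exact h3.trans h4
  have hξ := M.ξ₀_mem_U s
  have hLp : ∀ x ∈ Icc M.priceMin M.priceMax, MemLp (fun t =>
      |M.h s t (Function.update (fun r => π r t) s x) (M.ξ₀ s)|) 2 M.μ := fun x hx =>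
    (hM.memLp_constant_ownPrice hπ hξ hx).abs
  -- The envelope adds `priceMax` to the demand bound, so that it dominates prices and demands at
  -- once.
  have hH := (((hLp _ (left_mem_Icc.2 hle)).add (hLp _ (right_mem_Icc.2 hle))).add
    ((hLp ((M.priceMin + M.priceMax) / 2) ⟨by linarith, by linarith⟩).const_mul 2)).add
    (memLp_const M.priceMax)
  have hwW : ∀ᵐ t ∂M.μ, |Real.exp (-M.ρ * t)| ≤ Real.exp (|M.ρ| * M.t_f) := by
    filter_upwards [hmem] with t ht
    rw [abs_of_pos (Real.exp_pos _), Real.exp_le_exp]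
    have h0 : 0 ≤ t := M.t₀_nonneg.trans ht.1
    calc -M.ρ * t ≤ |M.ρ| * t := by gcongr; exact neg_le_abs _
      _ ≤ |M.ρ| * M.t_f := by gcongr; exact ht.2
  obtain ⟨v, hv, hmax⟩ := exists_max_integral_weight_mul
    (w := fun t => Real.exp (-M.ρ * t)) (by fun_prop) hwW (fun t => Real.exp_pos _)
    (C := fun t => M.robustSection s (fun r => π r t) t)
    (by filter_upwards [hbox, hmem] with t hb ht using hM.isClosed_robustSection ht hb)
    (by filter_upwards [hbox, hmem] with t hb ht using hM.convex_robustSection ht hb)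
    M.demandMin_pos (Eventually.of_forall fun t x d h => h.2.1)
    (Eventually.of_forall fun t x d d' h h1 h2 => ⟨h.1, h1, fun ξ hξ => h2.trans (h.2.2 ξ hξ)⟩)
    hH
    (by
      filter_upwards [hbox, hmem] with t hb ht x d h
      have h1 := hM.demand_le ht hb hξ h.1
      have h2 := h.2.2 _ hξ
      have h3 : 0 ≤ x := M.priceMin_nonneg.trans h.1.1
      have h4 : 0 ≤ d := M.demandMin_pos.le.trans h.2.1
      have h5 : x ≤ M.priceMax := h.1.2
      simp only at h2
      rw [abs_of_nonneg h3, abs_of_nonneg h4]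
      simp only [Pi.add_apply]
      exact ⟨by linarith, by linarith⟩)
    (M.K s) (hM.robustStrategySpace_eq hπ) hne
  exact ⟨v, hv, hmax⟩
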